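/- **Setting.** Let $n$ individuals be given. For $i\in[n]=\{1,\dots,n\}$ let the record universe $\mathcal X_i$ be a $\sigma$-compact Polish space (for instance a closed or an open subset of some $\mathbb R^{d}$), let $\mathcal X=\prod_{i}\mathcal X_i$ and $\mathcal X_{(i)}=\prod_{j\ne i}\mathcal X_j$, and write $x=(x_i,x_{(i)})$. Let $\mathcal Y$ be a second countable topological space with a $\sigma$-finite Borel measure $dy$ (for instance a Borel subset of $\mathbb R^m$ with Lebesgue measure). A channel from $\mathcal X_i$ to $\mathcal Y$ is a jointly measurable function $q(y|x_i)\in[0,\infty]$ with $\int q(y|x_i)\,dy=1$ for every $x_i$. Let $p(y|x)\in[0,\infty)$ be a privacy channel, that is, a jointly measurable function with $\int p(y|x)\,dy=1$ for every $x\in\mathcal X$. Let $\mathbb Q_i$ be the set of all channels of the form $$p(y|x_i)=\int_{\mathcal X_{(i)}}p(y|x_i,x_{(i)})\,\mu^{x_i}(dx_{(i)})\qquad\text{for all }x_i,y,$$ where $x_i\mapsto\mu^{x_i}$ is any transition probability from $\mathcal X_i$ to $\mathcal X_{(i)}$ (point masses are allowed), and let $\mathbb S_i$ be the set of all channels $q(y|x_i)$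 from $\mathcal X_i$ to $\mathcal Y$ such that for each $x_i$ there is an $x_{(i)}\in\mathcal X_{(i)}$ with $q(y|x_i)=p(y|x_i,x_{(i)})$ for all $y$. Mutual information $I$ is the relative entropy, with natural logarithm, of the joint law with respect to the product of its marginals. For each $i$ let $\mathbb P_i$ be a set of Borel probability measures on $\mathcal X_i$: all of them, or any smaller class, such as those with a density. The individual channel capacity of $p(y|x)$ is $$C_1=\max_{i\in[n],\,X}I(X_i;Y),$$ where $X=(X_1,\dots,X_n)$ runs over all random elements of $\mathcal X$ such that the law of $X_i$ is in $\mathbb P_i$ (over all random elements of $\mathcal X$ if each $\mathbb P_i$ consists of all Borel probability measures), and $Y$ is the output of the channel $p(y|x)$ with input $X$. **Theorem 2.** Assume that $p(y|x)$ is continuous on $\mathcal Y\times\mathcal X$. Then $\mathbb S_i\subseteq\mathbb Q_i$ for every $i\in[n]$. Moreover, if the individual channel capacity $C_1$ exists (the maximum is attained and finite), then $$C_1=\max_{i\in[n]}\ \max_{p(y|x_i)\in\mathbb Q_i}\ \max_{p(x_i)\in\mathbb P_i}I(X_i;Y)=\max_{i\in[n]}\ \max_{p(y|x_i)\in\mathbb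 S_i}\ \max_{p(x_i)\in\mathbb P_i}I(X_i;Y),$$ where in the last two expressions $X_i$ has law $p(x_i)$, $Y$ is the output of the channel $p(y|x_i)$, and the iterated maximum means the maximum over all triples (index, channel, input law), which is attained. -/

import Mathlib

open MeasureTheory ProbabilityTheory
open scoped ENNReal NNReal

namespace InfoPrivacy

/-- A channel from `α` to `𝒴`, given by its transition density `q a y = p(y|a)` with respect to the
reference measure `ν` (`dy`) on `𝒴`. Densities take values in `[0, ∞]`, so that mixtures
of densities always make sense. -/
def IsChannel {α 𝒴 : Type*} [MeasurableSpace α] [MeasurableSpace 𝒴] (ν : Measure 𝒴)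
    (q : α → 𝒴 → ℝ≥0∞) : Prop :=
  Measurable (Function.uncurry q) ∧ ∀ a, ∫⁻ y, q a y ∂ν = 1

/-- The joint law `μ(da) q(y|a) dy` of the input and the output of the channel `q` when the input
has law `μ`. -/
noncomputable def jointLaw {α 𝒴 : Type*} [MeasurableSpace α] [MeasurableSpace 𝒴] (ν : Measure 𝒴)
    (q : α → 𝒴 → ℝ≥0∞) (μ : Measure α) : Measure (α × 𝒴) :=
  (μ.prod ν).withDensity (Function.uncurry q)

/-- The mutual information `I(U;V)` (in nats) of a pair `(U,V)` with joint law `J`: the relative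
entropy of the joint law with respect to the product of the marginals. -/
noncomputable def mutualInfo {α β : Type*} [MeasurableSpace α] [MeasurableSpace β]
    (J : Measure (α × β)) : ℝ≥0∞ :=
  InformationTheory.klDiv J (J.fst.prod J.snd)

section Privacy

variable {n : ℕ} {𝒳 : Fin n → Type*} {𝒴 : Type*}

/-- The dataset whose `i`-th record is `a` and whose other records are `z`. -/
def dataset (i : Fin n) (a : 𝒳 i) (z : ∀ j : {j : Fin n // j ≠ i}, 𝒳 j) : ∀ j, 𝒳 j :=
  (Equiv.piSplitAt i 𝒳).symm (a, z)

variable [∀ i, MeasurableSpace (𝒳 i)] [MeasurableSpace 𝒴]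

/-- A privacy channel `p(y|x)`, `p x y = p(y|x)`, with densities with respect to `ν`. -/
def IsPrivacyChannel (ν : Measure 𝒴) (p : (∀ j, 𝒳 j) → 𝒴 → ℝ≥0) : Prop :=
  IsChannel ν (fun x y => (p x y : ℝ≥0∞))

/-- `I(X_i;Y)` where the dataset `X` has law `P` and `Y` is the output of the privacy channel `p`
on the input `X`. -/
noncomputable def recordInfo (ν : Measure 𝒴) (p : (∀ j, 𝒳 j) → 𝒴 → ℝ≥0) (P : Measure (∀ j, 𝒳 j))
    (i : Fin n) : ℝ≥0∞ :=
  mutualInfo ((jointLaw ν (fun x y => (p x y : ℝ≥0∞)) P).map fun w => (w.1 i, w.2))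

/-- The set `ℚ_i` of all channels `p(y|x_i) = ∫ p(y|x_i,x_(i)) p(dx_(i)|x_i)`, where
`p(dx_(i)|x_i)` runs over all transition probabilities from `𝒳_i` to `𝒳_(i)`. -/
def channelsQ (ν : Measure 𝒴) (p : (∀ j, 𝒳 j) → 𝒴 → ℝ≥0) (i : Fin n) :
    Set (𝒳 i → 𝒴 → ℝ≥0∞) :=
  {q | IsChannel ν q ∧
    ∃ κ : Kernel (𝒳 i) (∀ j : {j : Fin n // j ≠ i}, 𝒳 j), IsMarkovKernel κ ∧
      ∀ a y, q a y = ∫⁻ z, (p (dataset i a z) y : ℝ≥0∞) ∂(κ a)}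

/-- The set `𝕊_i` of all channels `p(y|x_i)` such that for each `x_i` there is `x_(i)` with
`p(y|x_i) = p(y|x_i,x_(i))` for all `y`. -/
def channelsS (ν : Measure 𝒴) (p : (∀ j, 𝒳 j) → 𝒴 → ℝ≥0) (i : Fin n) :
    Set (𝒳 i → 𝒴 → ℝ≥0∞) :=
  {q | IsChannel ν q ∧
    ∀ a, ∃ z : (∀ j : {j : Fin n // j ≠ i}, 𝒳 j), ∀ y, q a y = (p (dataset i a z) y : ℝ≥0∞)}

/-- `C` is the individual channel capacity `max_{i, X} I(X_i;Y)`, the maximum being attained.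
Here `𝓛 i` is the universe of admissible laws of `X_i`
(all laws for `𝓛 i = Set.univ`, or for instance only those with a Lebesgue density), and `X` runs
over all random datasets whose `i`-th record has an admissible law. -/
def IsIndividualCapacity (ν : Measure 𝒴) (p : (∀ j, 𝒳 j) → 𝒴 → ℝ≥0)
    (𝓛 : ∀ i, Set (Measure (𝒳 i))) (C : ℝ≥0∞) : Prop :=
  IsGreatest {r | ∃ i, ∃ P : Measure (∀ j, 𝒳 j), IsProbabilityMeasure P ∧
    P.map (fun x => x i) ∈ 𝓛 i ∧ r = recordInfo ν p P i} C

/-- `C = max_i max_{q ∈ 𝒞_i} max_{μ ∈ 𝓛_i} I(X_i;Y)`, the maximum being attained, where `X_i` has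
law `μ` and `Y` is the output of the channel `q` on the input `X_i`. -/
def IsMaxInfo (ν : Measure 𝒴) (𝒞 : ∀ i, Set (𝒳 i → 𝒴 → ℝ≥0∞))
    (𝓛 : ∀ i, Set (Measure (𝒳 i))) (C : ℝ≥0∞) : Prop :=
  IsGreatest {r | ∃ i, ∃ q ∈ 𝒞 i, ∃ μ ∈ 𝓛 i, IsProbabilityMeasure μ ∧
    r = mutualInfo (jointLaw ν q μ)} C

end Privacy

end InfoPrivacy

/-!
Splitting a dataset into its `i`-th record and the rest identifies a law `P` of the dataset with a
pair `(μ, κ)`: the law of the record and the conditional law of the rest (disintegration on standard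
Borel spaces). Under this identification `recordInfo ν p P i` is the mutual information of the
mixed channel `q(y|a) = ∫ p(y|a,z) κ(a,dz)` with input law `μ` (`recordInfo_map_dataset`,
`exists_kernel_map_dataset_eq`). Hence the individual capacity and the maximum over `ℚ_i` are maxima
of one and the same set of numbers.

The inclusion `𝕊_i ⊆ ℚ_i` says that the record `z` in `q(·|a) = p(·|a,z)` can be chosen measurably
in `a`, so that the kernel `a ↦ δ_{z(a)}` gives `q`. By continuity in `y` the condition on `z` only
involves a countable dense set of outputs, so it reads `d a z ≤ 0` with `d` measurable in `a` and
continuous in `z`; the set-valued map of its solutions then has a measurable selection by the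
Kuratowski–Ryll-Nardzewski argument, σ-compactness supplying the measurability of the map
(`exists_measurable_le_zero`).

The inclusion bounds the maximum over `𝕊_i` from above. For the maximum to be attained on `𝕊_i`,
let `q ∈ ℚ_i` with kernel `κ` be a maximiser. Write `κ a` as the law of `f a U` with `U` uniform
on `[0,1]`. Then `q` is the mixture over `u` of the channels `q_u(y|a) = p(y|a,f a u)` of `𝕊_i`,
and mutual information is convex in the channel (`mutualInfo_jointLaw_mixture_le`, an instance of
the data processing inequality: forget `u`). So `I(q) ≤ ∫ I(q_u) du`, and some `q_u` does at least
as well as `q`.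
-/

namespace InfoPrivacy

open Set Filter Topology TopologicalSpace

/-! ### Measurable selection -/

section Selection

variable {α Z : Type*} [MeasurableSpace α]

/-- One step of the selection: `F` is cut down to balls of radius `ε` whose centres are chosen
measurably, and stays measurable in the sense of hitting closed sets measurably. -/
lemma exists_measurable_refinement [MetricSpace Z] [SeparableSpace Z] [Nonempty Z]
    [MeasurableSpace Z] [BorelSpace Z] {F : α → Set Z} (hne : ∀ a, (F a).Nonempty)
    (hF : ∀ C, IsClosed C → MeasurableSet {a | (F a ∩ C).Nonempty}) {ε : ℝ} (hε : 0 < ε) :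
    ∃ x : α → Z, Measurable x ∧
      (∀ a, (F a ∩ Metric.closedBall (x a) ε).Nonempty) ∧
      ∀ C, IsClosed C → MeasurableSet {a | (F a ∩ Metric.closedBall (x a) ε ∩ C).Nonempty} := by
  classical
  have hex : ∀ a, ∃ k, (F a ∩ Metric.closedBall (denseSeq Z k) ε).Nonempty := fun a => by
    obtain ⟨z, hz⟩ := hne a
    obtain ⟨k, hk⟩ := (denseRange_denseSeq Z).exists_dist_lt z hε
    exact ⟨k, z, hz, hk.le⟩
  have hk : Measurable fun a => Nat.find (hex a) :=
    measurable_find hex fun k => hF _ Metric.isClosed_closedBall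
  refine ⟨fun a => denseSeq Z (Nat.find (hex a)), ?_, fun a => Nat.find_spec (hex a),
    fun C hC => ?_⟩
  · exact measurable_from_top.comp hk
  · have : {a | (F a ∩ Metric.closedBall (denseSeq Z (Nat.find (hex a))) ε ∩ C).Nonempty} =
        ⋃ k, {a | Nat.find (hex a) = k} ∩
          {a | (F a ∩ (Metric.closedBall (denseSeq Z k) ε ∩ C)).Nonempty} := by
      ext a
      simp [inter_assoc]
    rw [this]
    exact .iUnion fun k => (hk (measurableSet_singleton k)).inter
      (hF _ (Metric.isClosed_closedBall.inter hC))

/-- **Kuratowski–Ryll-Nardzewski**, for set-valued maps that hit closed sets measurably: a map into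
the nonempty closed subsets of a Polish space has a measurable selection. -/
theorem exists_measurable_selection [TopologicalSpace Z] [PolishSpace Z] [MeasurableSpace Z]
    [BorelSpace Z] [Nonempty Z] {F : α → Set Z} (hcl : ∀ a, IsClosed (F a))
    (hne : ∀ a, (F a).Nonempty)
    (hF : ∀ C, IsClosed C → MeasurableSet {a | (F a ∩ C).Nonempty}) :
    ∃ f : α → Z, Measurable f ∧ ∀ a, f a ∈ F a := by
  let _ := upgradeIsCompletelyMetrizable Z
  have hpow : ∀ m : ℕ, (0 : ℝ) < (1 / 2) ^ m := fun m => by positivity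
  let T := {G : α → Set Z // (∀ a, (G a).Nonempty) ∧
    ∀ C, IsClosed C → MeasurableSet {a | (G a ∩ C).Nonempty}}
  choose x hxm hxne hxF using fun (G : T) (m : ℕ) =>
    exists_measurable_refinement G.2.1 G.2.2 (hpow m)
  -- `A (m + 1) a` is the part of `A m a` in a ball of radius `2⁻ᵐ`; the centres converge to the
  -- selection.
  let A : ℕ → T := fun m => Nat.rec ⟨F, hne, hF⟩
    (fun m G => ⟨fun a => G.1 a ∩ Metric.closedBall (x G m a) ((1 / 2) ^ m), hxne G m, hxF G m⟩) m
  have hA : ∀ m a, (A (m + 1)).1 a =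
    (A m).1 a ∩ Metric.closedBall (x (A m) m a) ((1 / 2) ^ m) := fun m a => rfl
  have hAF : ∀ m a, (A m).1 a ⊆ F a := by
    intro m a
    induction m with
    | zero => exact subset_rfl
    | succ m ih => exact (hA m a).trans_subset (inter_subset_left.trans ih)
  have hdist : ∀ a m, dist (x (A m) m a) (x (A (m + 1)) (m + 1) a) ≤ 2 * (1 / 2) ^ m := by
    intro a m
    obtain ⟨w, hw⟩ := (A (m + 2)).2.1 a
    rw [hA (m + 1), hA m] at hw
    have h1 : dist w (x (A m) m a) ≤ (1 / 2) ^ m := hw.1.2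
    have h2 : dist w (x (A (m + 1)) (m + 1) a) ≤ (1 / 2) ^ (m + 1) := hw.2
    have h3 := dist_triangle_left (x (A m) m a) (x (A (m + 1)) (m + 1) a) w
    have h4 := hpow m
    rw [pow_succ] at h2
    linarith
  choose f hf using fun a => cauchySeq_tendsto_of_complete
    (cauchySeq_of_le_geometric _ _ (by norm_num) (hdist a))
  refine ⟨f, measurable_of_tendsto_metrizable (fun m => hxm (A m) m) (tendsto_pi_nhds.2 hf),
    fun a => ?_⟩
  -- The selected points lie in `F a`: the centres are `2⁻ᵐ`-close to points `w m` of `F a`.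
  choose w hw using fun m => (A (m + 1)).2.1 a
  have hwx : Tendsto (fun m => dist (x (A m) m a) (w m)) atTop (𝓝 0) := by
    refine squeeze_zero (fun _ => dist_nonneg) (fun m => ?_)
      (tendsto_pow_atTop_nhds_zero_of_lt_one (by norm_num : (0 : ℝ) ≤ 1 / 2) (by norm_num))
    have := hw m
    rw [hA] at this
    rw [dist_comm]
    exact this.2
  exact (hcl a).mem_of_tendsto ((tendsto_iff_of_dist hwx).1 (hf a))
    (Eventually.of_forall fun m => hAF (m + 1) a (hw m))

lemma measurableSet_exists_mem_le_zero [TopologicalSpace Z] [PolishSpace Z] {d : α → Z → ℝ}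
    (hd : ∀ z, Measurable fun a => d a z) (hd' : ∀ a, Continuous (d a)) {K : Set Z}
    (hK : IsCompact K) : MeasurableSet {a | ∃ z ∈ K, d a z ≤ 0} := by
  -- By compactness a solution exists iff there are approximate solutions, and these can be taken in
  -- a countable dense subset of `K`.
  obtain ⟨D, hDK, hDc, hKD⟩ := (IsSeparable.of_separableSpace K).exists_countable_dense_subset
  have : {a | ∃ z ∈ K, d a z ≤ 0} = ⋂ m : ℕ, ⋃ z ∈ D, {a | d a z < 1 / ((m : ℝ) + 1)} := by
    ext a
    simp only [mem_ofPred_eq, mem_iInter, mem_iUnion, exists_prop]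
    constructor
    · rintro ⟨z, hz, hdz⟩ m
      have ho : IsOpen {z | d a z < 1 / ((m : ℝ) + 1)} := isOpen_lt (hd' a) continuous_const
      obtain ⟨w, hw, hwD⟩ := mem_closure_iff.1 (hKD hz) _ ho (hdz.trans_lt (by positivity))
      exact ⟨w, hwD, hw⟩
    · intro h
      obtain ⟨z₀, hz₀, -⟩ := h 0
      obtain ⟨z, hz, hmin⟩ := hK.exists_isMinOn ⟨z₀, hDK hz₀⟩ (hd' a).continuousOn
      refine ⟨z, hz, le_of_forall_pos_le_add fun ε hε => ?_⟩
      obtain ⟨m, hm⟩ := exists_nat_one_div_lt hε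
      obtain ⟨w, hw, hdw⟩ := h m
      have : d a z ≤ d a w := hmin (hDK hw)
      linarith
  rw [this]
  exact .iInter fun m => .biUnion hDc fun z _ => measurableSet_lt (hd z) measurable_const

/-- Measurable choice of a solution `z` of `d a z ≤ 0`, for `d` measurable in `a` and continuous in
`z` ranging over a σ-compact Polish space. Closed sets are countable unions of compact ones there,
which reduces the measurability to `measurableSet_exists_mem_le_zero`. -/
theorem exists_measurable_le_zero [TopologicalSpace Z] [PolishSpace Z] [SigmaCompactSpace Z]
    [MeasurableSpace Z] [BorelSpace Z] [Nonempty Z] {d : α → Z → ℝ}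
    (hd : ∀ z, Measurable fun a => d a z) (hd' : ∀ a, Continuous (d a))
    (hex : ∀ a, ∃ z, d a z ≤ 0) : ∃ f : α → Z, Measurable f ∧ ∀ a, d a (f a) ≤ 0 := by
  refine exists_measurable_selection (F := fun a => {z | d a z ≤ 0})
    (fun a => isClosed_le (hd' a) continuous_const) hex fun C hC => ?_
  have : {a | ({z | d a z ≤ 0} ∩ C).Nonempty} =
      ⋃ k, {a | ∃ z ∈ C ∩ compactCovering Z k, d a z ≤ 0} := by
    ext a
    simp only [mem_ofPred_eq, mem_iUnion]
    constructor
    · rintro ⟨z, hz, hzC⟩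
      obtain ⟨k, hk⟩ := exists_mem_compactCovering z
      exact ⟨k, z, ⟨hzC, hk⟩, hz⟩
    · rintro ⟨k, z, hz, hdz⟩
      exact ⟨z, hdz, hz.1⟩
  rw [this]
  exact .iUnion fun k =>
    measurableSet_exists_mem_le_zero hd hd' ((isCompact_compactCovering Z k).inter_left hC)

end Selection

/-! ### Mutual information is convex in the channel -/

section Information

open InformationTheory

variable {Ω α 𝒴 : Type*} [MeasurableSpace Ω] [MeasurableSpace α] [MeasurableSpace 𝒴]

/-- The relative entropy in terms of densities with respect to a common measure `m`, as the integral
of the perspective `(f, g) ↦ g * klFun (f / g)`. Where `g` is `0`, so is the integrand. -/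
lemma klDiv_withDensity_withDensity {m : Measure α} {f g : α → ℝ≥0∞}
    (hf : Measurable f) (hg : Measurable g) (hfi : ∫⁻ x, f x ∂m ≠ ∞) (hgi : ∫⁻ x, g x ∂m ≠ ∞)
    (hfg : ∀ᵐ x ∂m, g x = 0 → f x = 0) :
    klDiv (m.withDensity f) (m.withDensity g) =
      ∫⁻ x, g x * ENNReal.ofReal (klFun (f x / g x).toReal) ∂m := by
  have := isFiniteMeasure_withDensity hfi
  have := isFiniteMeasure_withDensity hgi
  have heq : m.withDensity f = (m.withDensity g).withDensity (f / g) := by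
    rw [← withDensity_mul _ hg (hf.div hg)]
    refine withDensity_congr_ae ?_
    filter_upwards [hfg, ae_lt_top hg hgi] with x h0 htop
    exact (ENNReal.mul_div_cancel' h0 fun h => absurd h htop.ne).symm
  have hac : m.withDensity f ≪ m.withDensity g :=
    heq ▸ withDensity_absolutelyContinuous _ _
  rw [klDiv_eq_lintegral_klFun_of_ac hac]
  have hrn : (m.withDensity f).rnDeriv (m.withDensity g) =ᵐ[m.withDensity g] f / g := by
    rw [heq]
    exact Measure.rnDeriv_withDensity _ (hf.div hg)
  rw [lintegral_congr_ae (g := fun x => ENNReal.ofReal (klFun (f x / g x).toReal))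
    (hrn.mono fun x hx => by simp only [hx, Pi.div_apply]),
    lintegral_withDensity_eq_lintegral_mul _ hg (by fun_prop)]
  rfl

lemma map_snd_withDensity_prod {l : Measure Ω} {m : Measure α} [SFinite l] [SFinite m]
    {F : Ω × α → ℝ≥0∞} (hF : Measurable F) :
    ((l.prod m).withDensity F).map Prod.snd = m.withDensity fun x => ∫⁻ u, F (u, x) ∂l := by
  refine Measure.ext_of_lintegral _ fun f hf => ?_
  have hf' : Measurable fun w : Ω × α => f w.2 := hf.comp measurable_snd
  rw [lintegral_map hf measurable_snd, lintegral_withDensity_eq_lintegral_mul _ hF hf',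
    lintegral_withDensity_eq_lintegral_mul _ hF.lintegral_prod_left' hf,
    lintegral_prod_symm' _ (hF.mul hf')]
  refine lintegral_congr fun x => ?_
  simp only [Pi.mul_apply]
  exact lintegral_mul_const (f := fun u => F (u, x)) _ (hF.comp measurable_prodMk_right)

variable {ν : Measure 𝒴} [SigmaFinite ν] {μ : Measure α}

/-- The channel densities integrate to `1`, so the input marginal is the input law. -/
lemma fst_jointLaw [SFinite μ] {q : α → 𝒴 → ℝ≥0∞} (hq : IsChannel ν q) : (jointLaw ν q μ).fst = μ := by
  refine Measure.ext_of_lintegral _ fun f hf => ?_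
  have hf' : Measurable fun w : α × 𝒴 => f w.1 := hf.comp measurable_fst
  rw [Measure.fst, lintegral_map hf measurable_fst, jointLaw,
    lintegral_withDensity_eq_lintegral_mul _ hq.1 hf',
    lintegral_prod _ (hq.1.mul hf').aemeasurable]
  refine lintegral_congr fun a => ?_
  have : Measurable (q a) := hq.1.of_uncurry_left
  simp only [Pi.mul_apply, Function.uncurry_apply_pair]
  rw [lintegral_mul_const _ this, hq.2, one_mul]

variable [IsProbabilityMeasure μ]

omit [SigmaFinite ν] in
lemma measurable_outputDensity {q : α → 𝒴 → ℝ≥0∞} (hq : IsChannel ν q) :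
    Measurable fun y => ∫⁻ a, q a y ∂μ :=
  hq.1.lintegral_prod_left'

omit [SigmaFinite ν] in
lemma measurable_outputDensity_snd {q : α → 𝒴 → ℝ≥0∞} (hq : IsChannel ν q) :
    Measurable fun w : α × 𝒴 => ∫⁻ a, q a w.2 ∂μ :=
  (measurable_outputDensity hq).comp measurable_snd

/-- The output has density `∫ q(y|a) μ(da)`, so mutual information compares two densities with
respect to `μ.prod ν`. -/
lemma mutualInfo_jointLaw {q : α → 𝒴 → ℝ≥0∞} (hq : IsChannel ν q) :
    mutualInfo (jointLaw ν q μ) = klDiv ((μ.prod ν).withDensity (Function.uncurry q))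
      ((μ.prod ν).withDensity fun w => ∫⁻ a, q a w.2 ∂μ) := by
  rw [mutualInfo, fst_jointLaw hq, Measure.snd, jointLaw, map_snd_withDensity_prod hq.1]
  have := prod_withDensity_right (μ := μ) (ν := ν) (measurable_outputDensity (μ := μ) hq)
  exact congrArg _ this

lemma ae_eq_zero_of_outputDensity_eq_zero {q : α → 𝒴 → ℝ≥0∞} (hq : IsChannel ν q) :
    ∀ᵐ w ∂μ.prod ν, ∫⁻ a, q a w.2 ∂μ = 0 → Function.uncurry q w = 0 := by
  have hmeas : MeasurableSet
      {w : α × 𝒴 | ∫⁻ a, q a w.2 ∂μ = 0 → Function.uncurry q w = 0} := by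
    exact (measurable_outputDensity_snd hq (measurableSet_singleton 0)).imp (hq.1 (measurableSet_singleton 0))
  rw [Measure.ae_prod_iff_ae_ae hmeas, Measure.ae_ae_comm hmeas]
  refine ae_of_all _ fun y => ?_
  by_cases h : ∫⁻ a, q a y ∂μ = 0
  · have : Measurable fun a => q a y := hq.1.of_uncurry_right
    filter_upwards [(lintegral_eq_zero_iff this).1 h] with a ha _ using ha
  · exact ae_of_all _ fun a h' => absurd h' h

lemma lintegral_uncurry_eq_one {q : α → 𝒴 → ℝ≥0∞} (hq : IsChannel ν q) :
    ∫⁻ w, Function.uncurry q w ∂μ.prod ν = 1 := by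
  rw [lintegral_prod _ hq.1.aemeasurable]
  simp [hq.2]

lemma lintegral_outputDensity_eq_one {q : α → 𝒴 → ℝ≥0∞} (hq : IsChannel ν q) :
    ∫⁻ w, ∫⁻ a, q a w.2 ∂μ ∂μ.prod ν = 1 := by
  rw [lintegral_prod _ (measurable_outputDensity_snd hq).aemeasurable]
  simp only [lintegral_const, measure_univ, mul_one]
  rw [← lintegral_lintegral_swap (f := fun a y => q a y) hq.1.aemeasurable]
  simp [hq.2]

/-- **Convexity of mutual information in the channel**, for arbitrary mixtures. Both sides are
relative entropies between laws of `(u, a, y)`: the right-hand side of the laws with densities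
`Q_u(y|a)` and `∫ Q_u(y|a') μ(da')`, the left-hand side of their images under forgetting `u`. -/
theorem mutualInfo_jointLaw_mixture_le {l : Measure Ω} [IsProbabilityMeasure l]
    {Q : Ω → α → 𝒴 → ℝ≥0∞} (hQ : ∀ u, IsChannel ν (Q u))
    (hQm : Measurable fun w : Ω × α × 𝒴 => Q w.1 w.2.1 w.2.2)
    {q : α → 𝒴 → ℝ≥0∞} (hq : IsChannel ν q) (hmix : ∀ a y, q a y = ∫⁻ u, Q u a y ∂l) :
    mutualInfo (jointLaw ν q μ) ≤ ∫⁻ u, mutualInfo (jointLaw ν (Q u) μ) ∂l := by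
  set R : Ω × α × 𝒴 → ℝ≥0∞ := fun w => ∫⁻ a, Q w.1 a w.2.2 ∂μ with hR
  have hRm : Measurable R := by
    have : Measurable fun v : (Ω × α × 𝒴) × α => Q v.1.1 v.2 v.1.2.2 :=
      hQm.comp (f := fun v : (Ω × α × 𝒴) × α => (v.1.1, v.2, v.1.2.2)) (by fun_prop)
    exact this.lintegral_prod_right'
  -- Averaging over `u` turns both densities into those that belong to `q`.
  have hJ : (μ.prod ν).withDensity (Function.uncurry q) =
      ((l.prod (μ.prod ν)).withDensity fun w => Q w.1 w.2.1 w.2.2).map Prod.snd := by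
    rw [map_snd_withDensity_prod hQm]
    exact congrArg _ (funext fun w => hmix w.1 w.2)
  have hM : ((μ.prod ν).withDensity fun w => ∫⁻ a, q a w.2 ∂μ) =
      ((l.prod (μ.prod ν)).withDensity R).map Prod.snd := by
    rw [map_snd_withDensity_prod hRm]
    refine congrArg _ (funext fun w => ?_)
    simp only [hmix, hR]
    refine lintegral_lintegral_swap (f := fun a u => Q u a w.2) (Measurable.aemeasurable ?_)
    exact hQm.comp (f := fun v : α × Ω => (v.2, v.1, w.2)) (by fun_prop)
  have hQi : ∫⁻ w, Q w.1 w.2.1 w.2.2 ∂l.prod (μ.prod ν) = 1 := by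
    rw [lintegral_prod _ hQm.aemeasurable]
    simp [show ∀ u, ∫⁻ w : α × 𝒴, Q u w.1 w.2 ∂μ.prod ν = 1 from
      fun u => lintegral_uncurry_eq_one (hQ u)]
  have hRi : ∫⁻ w, R w ∂l.prod (μ.prod ν) = 1 := by
    rw [lintegral_prod _ hRm.aemeasurable]
    simp [hR, show ∀ u, ∫⁻ w : α × 𝒴, ∫⁻ a, Q u a w.2 ∂μ ∂μ.prod ν = 1 from
      fun u => lintegral_outputDensity_eq_one (hQ u)]
  have hQR : ∀ᵐ w ∂l.prod (μ.prod ν), R w = 0 → Q w.1 w.2.1 w.2.2 = 0 := by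
    have hmeas : MeasurableSet {w : Ω × α × 𝒴 | R w = 0 → Q w.1 w.2.1 w.2.2 = 0} :=
      (hRm (measurableSet_singleton 0)).imp (hQm (measurableSet_singleton 0))
    rw [Measure.ae_prod_iff_ae_ae hmeas]
    exact ae_of_all _ fun u => ae_eq_zero_of_outputDensity_eq_zero (hQ u)
  have := isFiniteMeasure_withDensity (μ := l.prod (μ.prod ν)) (hQi.trans_ne ENNReal.one_ne_top)
  have := isFiniteMeasure_withDensity (μ := l.prod (μ.prod ν)) (hRi.trans_ne ENNReal.one_ne_top)
  rw [mutualInfo_jointLaw hq, hJ, hM]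
  -- After data processing, both sides are integrals of the same function of `(u, a, y)`.
  refine (klDiv_map_le _ _ measurable_snd).trans_eq ?_
  rw [klDiv_withDensity_withDensity hQm hRm (by simp [hQi]) (by simp [hRi]) hQR,
    lintegral_prod _ (by fun_prop)]
  refine lintegral_congr fun u => ?_
  rw [mutualInfo_jointLaw (hQ u), klDiv_withDensity_withDensity (hQ u).1
    (measurable_outputDensity_snd (hQ u))
    (by simp [lintegral_uncurry_eq_one (hQ u)]) (by simp [lintegral_outputDensity_eq_one (hQ u)])
    (ae_eq_zero_of_outputDensity_eq_zero (hQ u))]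
  rfl

end Information

/-! ### Laws of datasets and mixed channels -/

section Channels

variable {n : ℕ} {𝒳 : Fin n → Type*} {𝒴 : Type*}

lemma dataset_self (i : Fin n) (a : 𝒳 i) (z : ∀ j : {j : Fin n // j ≠ i}, 𝒳 j) :
    dataset i a z i = a := by
  simp [dataset, Equiv.piSplitAt]

lemma dataset_eta (i : Fin n) (x : ∀ j, 𝒳 j) : dataset i (x i) (fun j => x j) = x :=
  (Equiv.piSplitAt i 𝒳).symm_apply_apply x

lemma continuous_dataset [∀ i, TopologicalSpace (𝒳 i)] (i : Fin n) :
    Continuous fun w : 𝒳 i × (∀ j : {j : Fin n // j ≠ i}, 𝒳 j) => dataset i w.1 w.2 :=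
  (Homeomorph.piSplitAt i 𝒳).symm.continuous

variable [∀ i, MeasurableSpace (𝒳 i)] [MeasurableSpace 𝒴]

lemma measurable_dataset (i : Fin n) :
    Measurable fun w : 𝒳 i × (∀ j : {j : Fin n // j ≠ i}, 𝒳 j) => dataset i w.1 w.2 := by
  refine measurable_pi_lambda _ fun j => ?_
  by_cases h : j = i
  · subst h
    simpa only [dataset_self] using measurable_fst
  · have : (fun w : 𝒳 i × (∀ j : {j : Fin n // j ≠ i}, 𝒳 j) => dataset i w.1 w.2 j) =
        fun w => w.2 ⟨j, h⟩ := by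
      ext w
      simp [dataset, Equiv.piSplitAt, h]
    rw [this]
    exact (measurable_pi_apply _).comp measurable_snd

variable {ν : Measure 𝒴} {p : (∀ j, 𝒳 j) → 𝒴 → ℝ≥0}

lemma IsPrivacyChannel.measurable (hp : IsPrivacyChannel ν p) :
    Measurable fun w : (∀ j, 𝒳 j) × 𝒴 => (p w.1 w.2 : ℝ≥0∞) :=
  hp.1

lemma IsPrivacyChannel.measurable_dataset (hp : IsPrivacyChannel ν p) (i : Fin n) :
    Measurable fun w : (𝒳 i × (∀ j : {j : Fin n // j ≠ i}, 𝒳 j)) × 𝒴 =>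
      (p (dataset i w.1.1 w.1.2) w.2 : ℝ≥0∞) :=
  hp.measurable.comp (((InfoPrivacy.measurable_dataset i).comp measurable_fst).prodMk
    measurable_snd)

lemma isChannel_dataset_comp (hp : IsPrivacyChannel ν p) {i : Fin n}
    {f : 𝒳 i → ∀ j : {j : Fin n // j ≠ i}, 𝒳 j} (hf : Measurable f) :
    IsChannel ν fun a y => (p (dataset i a (f a)) y : ℝ≥0∞) := by
  refine ⟨(hp.measurable_dataset i).comp (f := fun w : 𝒳 i × 𝒴 => ((w.1, f w.1), w.2))
    (by fun_prop), fun a => hp.2 _⟩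

/-- Every kernel from the `i`-th record to the other records gives a channel in `ℚ_i`. -/
lemma isChannel_lintegral [SigmaFinite ν] (hp : IsPrivacyChannel ν p) {i : Fin n}
    (κ : Kernel (𝒳 i) (∀ j : {j : Fin n // j ≠ i}, 𝒳 j)) [IsMarkovKernel κ] :
    IsChannel ν fun a y => ∫⁻ z, (p (dataset i a z) y : ℝ≥0∞) ∂κ a := by
  have hm := hp.measurable_dataset i
  constructor
  · have h : Measurable fun v : (𝒳 i × 𝒴) × (∀ j : {j : Fin n // j ≠ i}, 𝒳 j) =>
        (p (dataset i v.1.1 v.2) v.1.2 : ℝ≥0∞) :=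
      hm.comp (f := fun v : (𝒳 i × 𝒴) × (∀ j : {j : Fin n // j ≠ i}, 𝒳 j) =>
        ((v.1.1, v.2), v.1.2)) (by fun_prop)
    exact h.lintegral_kernel_prod_right' (κ := κ.comap Prod.fst measurable_fst)
  · intro a
    rw [lintegral_lintegral_swap]
    · have : ∀ z, ∫⁻ y, (p (dataset i a z) y : ℝ≥0∞) ∂ν = 1 := fun z => hp.2 _
      simp [this]
    · exact (hm.comp (f := fun v : 𝒴 × (∀ j : {j : Fin n // j ≠ i}, 𝒳 j) =>
        ((a, v.2), v.1)) (by fun_prop)).aemeasurable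

/-- If the dataset has record law `μ` and conditional law `κ` of the rest, then the pair of the
`i`-th record and the output is produced by the `κ`-mixture of the privacy channel. -/
lemma map_jointLaw_dataset [SigmaFinite ν] (hp : IsPrivacyChannel ν p) {i : Fin n}
    (μ : Measure (𝒳 i)) [SFinite μ]
    (κ : Kernel (𝒳 i) (∀ j : {j : Fin n // j ≠ i}, 𝒳 j)) [IsMarkovKernel κ] :
    (jointLaw ν (fun x y => (p x y : ℝ≥0∞))
      ((μ ⊗ₘ κ).map fun w => dataset i w.1 w.2)).map (fun w => (w.1 i, w.2)) =
    jointLaw ν (fun a y => ∫⁻ z, (p (dataset i a z) y : ℝ≥0∞) ∂κ a) μ := by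
  have hq := isChannel_lintegral hp κ
  have hm := hp.measurable_dataset i
  have hpi : Measurable fun w : (∀ j, 𝒳 j) × 𝒴 => (w.1 i, w.2) := by fun_prop
  refine Measure.ext_of_lintegral _ fun f hf => ?_
  have hfi : Measurable fun w : (∀ j, 𝒳 j) × 𝒴 => f (w.1 i, w.2) := hf.comp hpi
  have hpf : Measurable fun w : (∀ j, 𝒳 j) × 𝒴 => (p w.1 w.2 : ℝ≥0∞) * f (w.1 i, w.2) :=
    hp.measurable.mul hfi
  calc ∫⁻ w, f w ∂(jointLaw ν (fun x y => (p x y : ℝ≥0∞))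
        ((μ ⊗ₘ κ).map fun w => dataset i w.1 w.2)).map (fun w => (w.1 i, w.2))
      = ∫⁻ x, ∫⁻ y, (p x y : ℝ≥0∞) * f (x i, y) ∂ν
          ∂((μ ⊗ₘ κ).map fun w => dataset i w.1 w.2) := by
        rw [lintegral_map hf hpi, jointLaw,
          lintegral_withDensity_eq_lintegral_mul _ hp.1 hfi]
        exact lintegral_prod _ hpf.aemeasurable
    _ = ∫⁻ a, ∫⁻ z, ∫⁻ y, (p (dataset i a z) y : ℝ≥0∞) * f (a, y) ∂ν ∂κ a ∂μ := by
        have hg : Measurable fun x : ∀ j, 𝒳 j => ∫⁻ y, (p x y : ℝ≥0∞) * f (x i, y) ∂ν :=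
          hpf.lintegral_prod_right'
        have hgd : Measurable fun w : 𝒳 i × (∀ j : {j : Fin n // j ≠ i}, 𝒳 j) =>
            ∫⁻ y, (p (dataset i w.1 w.2) y : ℝ≥0∞) * f (dataset i w.1 w.2 i, y) ∂ν :=
          hg.comp (InfoPrivacy.measurable_dataset i)
        rw [lintegral_map hg (InfoPrivacy.measurable_dataset i), Measure.lintegral_compProd hgd]
        simp only [dataset_self]
    _ = ∫⁻ a, ∫⁻ y, (∫⁻ z, (p (dataset i a z) y : ℝ≥0∞) ∂κ a) * f (a, y) ∂ν ∂μ := by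
        refine lintegral_congr fun a => ?_
        have hma : Measurable fun v : (∀ j : {j : Fin n // j ≠ i}, 𝒳 j) × 𝒴 =>
            (p (dataset i a v.1) v.2 : ℝ≥0∞) :=
          hm.comp (f := fun v : (∀ j : {j : Fin n // j ≠ i}, 𝒳 j) × 𝒴 => ((a, v.1), v.2))
            (by fun_prop)
        have hfa : Measurable fun v : (∀ j : {j : Fin n // j ≠ i}, 𝒳 j) × 𝒴 => f (a, v.2) := by
          fun_prop
        rw [lintegral_lintegral_swap (hma.mul hfa).aemeasurable]
        exact lintegral_congr fun y => lintegral_mul_const _ (hma.comp measurable_prodMk_right)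
    _ = _ := by
        rw [jointLaw, lintegral_withDensity_eq_lintegral_mul _ hq.1 hf,
          lintegral_prod _ (hq.1.mul hf).aemeasurable]
        rfl

lemma recordInfo_map_dataset [SigmaFinite ν] (hp : IsPrivacyChannel ν p) {i : Fin n}
    (μ : Measure (𝒳 i)) [SFinite μ]
    (κ : Kernel (𝒳 i) (∀ j : {j : Fin n // j ≠ i}, 𝒳 j)) [IsMarkovKernel κ] :
    recordInfo ν p ((μ ⊗ₘ κ).map fun w => dataset i w.1 w.2) i =
      mutualInfo (jointLaw ν (fun a y => ∫⁻ z, (p (dataset i a z) y : ℝ≥0∞) ∂κ a) μ) := by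
  rw [recordInfo, map_jointLaw_dataset hp]

lemma map_eval_map_dataset {i : Fin n} (μ : Measure (𝒳 i)) [SFinite μ]
    (κ : Kernel (𝒳 i) (∀ j : {j : Fin n // j ≠ i}, 𝒳 j)) [IsMarkovKernel κ] :
    ((μ ⊗ₘ κ).map fun w => dataset i w.1 w.2).map (fun x => x i) = μ := by
  rw [Measure.map_map (measurable_pi_apply i) (measurable_dataset i)]
  have : (fun x : ∀ j, 𝒳 j => x i) ∘ (fun w : 𝒳 i × (∀ j : {j : Fin n // j ≠ i}, 𝒳 j) =>
      dataset i w.1 w.2) = Prod.fst := funext fun w => dataset_self i w.1 w.2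
  rw [this]
  exact Measure.fst_compProd μ κ

/-- Every law of the dataset arises from its record law and a conditional law of the rest. -/
lemma exists_kernel_map_dataset_eq [∀ i, StandardBorelSpace (𝒳 i)]
    (P : Measure (∀ j, 𝒳 j)) [IsProbabilityMeasure P] (i : Fin n) :
    ∃ κ : Kernel (𝒳 i) (∀ j : {j : Fin n // j ≠ i}, 𝒳 j), IsMarkovKernel κ ∧
      (((P.map fun x => x i) ⊗ₘ κ).map fun w => dataset i w.1 w.2) = P := by
  obtain ⟨x₀⟩ := P.nonempty_of_neZero
  have : Nonempty (∀ j : {j : Fin n // j ≠ i}, 𝒳 j) := ⟨fun j => x₀ j⟩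
  have hs : Measurable fun x : ∀ j, 𝒳 j => (x i, fun j : {j : Fin n // j ≠ i} => x j) := by
    fun_prop
  set ρ := P.map fun x => (x i, fun j : {j : Fin n // j ≠ i} => x j) with hρ
  have : IsProbabilityMeasure ρ := Measure.isProbabilityMeasure_map hs.aemeasurable
  have hfst : ρ.fst = P.map fun x => x i := by
    rw [Measure.fst, hρ, Measure.map_map measurable_fst hs]
    rfl
  refine ⟨ρ.condKernel, inferInstance, ?_⟩
  rw [← hfst, ρ.disintegrate, hρ, Measure.map_map (measurable_dataset i) hs]
  have : (fun w : 𝒳 i × (∀ j : {j : Fin n // j ≠ i}, 𝒳 j) => dataset i w.1 w.2) ∘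
      (fun x : ∀ j, 𝒳 j => (x i, fun j : {j : Fin n // j ≠ i} => x j)) = id :=
    funext fun x => dataset_eta i x
  rw [this, Measure.map_id]

/-- Every channel in `ℚ_i` is a mixture of channels in `𝕊_i`, one of which has at least the same
mutual information. The common finite bound `C` makes the average of the mutual informations finite;
an infinite average need not be attained. -/
theorem exists_mem_channelsS_mutualInfo_le [∀ i, StandardBorelSpace (𝒳 i)] [SigmaFinite ν]
    (hp : IsPrivacyChannel ν p) {i : Fin n} (μ : Measure (𝒳 i)) [IsProbabilityMeasure μ]
    {q : 𝒳 i → 𝒴 → ℝ≥0∞} (hq : q ∈ channelsQ ν p i) {C : ℝ≥0∞} (hCtop : C ≠ ∞)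
    (hC : ∀ s ∈ channelsS ν p i, mutualInfo (jointLaw ν s μ) ≤ C) :
    ∃ s ∈ channelsS ν p i, mutualInfo (jointLaw ν q μ) ≤ mutualInfo (jointLaw ν s μ) := by
  obtain ⟨hqc, κ, hκ, hqκ⟩ := hq
  obtain ⟨a₀⟩ := μ.nonempty_of_neZero
  have := (κ a₀).nonempty_of_neZero
  obtain ⟨f, hf, hfκ⟩ := κ.exists_measurable_map_eq_unitInterval
  have hfu : ∀ u, Measurable fun a => f a u := fun u => hf.of_uncurry_right
  have hfS : ∀ u, (fun a y => (p (dataset i a (f a u)) y : ℝ≥0∞)) ∈ channelsS ν p i :=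
    fun u => ⟨isChannel_dataset_comp hp (hfu u), fun a => ⟨f a u, fun _ => rfl⟩⟩
  have hle := mutualInfo_jointLaw_mixture_le (μ := μ) (l := (volume : Measure unitInterval))
    (fun u => (hfS u).1)
    ((hp.measurable_dataset i).comp
      (f := fun w : unitInterval × 𝒳 i × 𝒴 => ((w.2.1, f w.2.1 w.1), w.2.2))
      ((measurable_snd.fst.prodMk (hf.comp (measurable_snd.fst.prodMk measurable_fst))).prodMk
        measurable_snd.snd))
    hqc (fun a y => by
      have h : Measurable fun z => (p (dataset i a z) y : ℝ≥0∞) :=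
        (hp.measurable_dataset i).comp
          (f := fun z : ∀ j : {j : Fin n // j ≠ i}, 𝒳 j => ((a, z), y)) (by fun_prop)
      rw [hqκ, ← hfκ, lintegral_map h hf.of_uncurry_left])
  have hfin : ∫⁻ u, mutualInfo (jointLaw ν (fun a y => (p (dataset i a (f a u)) y : ℝ≥0∞)) μ)
      ∂(volume : Measure unitInterval) ≠ ∞ := by
    refine ne_top_of_le_ne_top hCtop ((lintegral_mono fun u => hC _ (hfS u)).trans_eq ?_)
    simp
  obtain ⟨u, hu⟩ := exists_lintegral_le hfin
  exact ⟨_, hfS u, hle.trans hu⟩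

/-- The record `z` in the definition of `𝕊_i` can be chosen measurably in `a`, so that a
deterministic kernel exhibits the channel as an element of `ℚ_i`. -/
theorem channelsS_subset_channelsQ [∀ i, TopologicalSpace (𝒳 i)] [∀ i, PolishSpace (𝒳 i)]
    [∀ i, SigmaCompactSpace (𝒳 i)] [∀ i, BorelSpace (𝒳 i)] [TopologicalSpace 𝒴]
    [SecondCountableTopology 𝒴] (hp : IsPrivacyChannel ν p)
    (hcont : Continuous fun w : 𝒴 × (∀ j, 𝒳 j) => p w.2 w.1) (i : Fin n) :
    channelsS ν p i ⊆ channelsQ ν p i := by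
  rintro q ⟨hq, hex⟩
  refine ⟨hq, ?_⟩
  suffices h : ∃ f : 𝒳 i → ∀ j : {j : Fin n // j ≠ i}, 𝒳 j, Measurable f ∧
      ∀ a y, q a y = p (dataset i a (f a)) y by
    obtain ⟨f, hf, hqf⟩ := h
    refine ⟨Kernel.deterministic f hf, inferInstance, fun a y => ?_⟩
    have : Measurable fun z => (p (dataset i a z) y : ℝ≥0∞) :=
      (hp.measurable_dataset i).comp
        (f := fun z : ∀ j : {j : Fin n // j ≠ i}, 𝒳 j => ((a, z), y)) (by fun_prop)
    rw [Kernel.deterministic_apply, lintegral_dirac' _ this, hqf]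
  rcases isEmpty_or_nonempty (𝒳 i) with hE | ⟨⟨a₀⟩⟩
  · exact ⟨fun a => (hE.false a).elim, measurable_of_empty _, fun a => (hE.false a).elim⟩
  obtain ⟨z₀, -⟩ := hex a₀
  have : Nonempty (∀ j : {j : Fin n // j ≠ i}, 𝒳 j) := ⟨z₀⟩
  -- Agreement of the densities on the countable dense set `D` is agreement of two points of the
  -- metrizable space `D → ℝ≥0`, measured by the distance `d a z` below.
  obtain ⟨D, hDc, hDd⟩ := exists_countable_dense 𝒴
  have := hDc.to_subtype
  let _ : MetricSpace (D → ℝ≥0) := metrizableSpaceMetric _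
  have hc : Continuous fun v : (𝒳 i × (∀ j : {j : Fin n // j ≠ i}, 𝒳 j)) × 𝒴 =>
      p (dataset i v.1.1 v.1.2) v.2 :=
    hcont.comp (continuous_snd.prodMk ((continuous_dataset i).comp continuous_fst))
  have hΦ : Continuous fun (w : 𝒳 i × (∀ j : {j : Fin n // j ≠ i}, 𝒳 j)) (y : D) =>
      p (dataset i w.1 w.2) y :=
    continuous_pi fun y => hc.comp (continuous_id.prodMk continuous_const)
  have hψ : Measurable fun (a : 𝒳 i) (y : D) => (q a y).toNNReal :=
    measurable_pi_lambda _ fun y => (hq.1.of_uncurry_right).ennreal_toNNReal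
  obtain ⟨f, hf, hdf⟩ := exists_measurable_le_zero
    (d := fun a z => dist (fun y : D => p (dataset i a z) y) (fun y : D => (q a y).toNNReal))
    (fun z => (hΦ.comp (continuous_id.prodMk continuous_const)).measurable.dist hψ)
    (fun a => (hΦ.comp (continuous_const.prodMk continuous_id)).dist continuous_const)
    (fun a => by
      obtain ⟨z, hz⟩ := hex a
      exact ⟨z, by simp [hz]⟩)
  refine ⟨f, hf, fun a y => ?_⟩
  obtain ⟨z, hz⟩ := hex a
  have hcz : ∀ z, Continuous (p (dataset i a z)) := fun z =>
    hc.comp (f := fun y => ((a, z), y)) (by fun_prop)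
  have heq : p (dataset i a (f a)) = p (dataset i a z) := by
    refine Continuous.ext_on hDd (hcz _) (hcz _) fun y hy => ?_
    have := congrFun (dist_le_zero.1 (hdf a)) ⟨y, hy⟩
    simpa [hz] using this
  rw [hz, heq]

end Channels
end InfoPrivacy

theorem theorem2 {n : ℕ} {𝒳 : Fin n → Type*} {𝒴 : Type*}
    [∀ i, TopologicalSpace (𝒳 i)] [∀ i, PolishSpace (𝒳 i)] [∀ i, SigmaCompactSpace (𝒳 i)]
    [∀ i, MeasurableSpace (𝒳 i)] [∀ i, BorelSpace (𝒳 i)]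
    [TopologicalSpace 𝒴] [SecondCountableTopology 𝒴] [MeasurableSpace 𝒴] [BorelSpace 𝒴]
    (ν : MeasureTheory.Measure 𝒴) [MeasureTheory.SigmaFinite ν]
    (p : (∀ j, 𝒳 j) → 𝒴 → ℝ≥0) (hp : InfoPrivacy.IsPrivacyChannel ν p)
    (hcont : Continuous (fun w : 𝒴 × (∀ j, 𝒳 j) => p w.2 w.1)) :
    (∀ i, InfoPrivacy.channelsS ν p i ⊆ InfoPrivacy.channelsQ ν p i) ∧
    ∀ (𝓛 : ∀ i, Set (MeasureTheory.Measure (𝒳 i))) (C₁ : ℝ≥0),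
      InfoPrivacy.IsIndividualCapacity ν p 𝓛 C₁ →
        InfoPrivacy.IsMaxInfo ν (InfoPrivacy.channelsQ ν p) 𝓛 C₁ ∧
        InfoPrivacy.IsMaxInfo ν (InfoPrivacy.channelsS ν p) 𝓛 C₁ := by
  have hS := fun i => InfoPrivacy.channelsS_subset_channelsQ hp hcont i
  refine ⟨hS, fun 𝓛 C₁ hC => ?_⟩
  have hPle : ∀ i (P : Measure (∀ j, 𝒳 j)), IsProbabilityMeasure P → P.map (fun x => x i) ∈ 𝓛 i →
      InfoPrivacy.recordInfo ν p P i ≤ C₁ :=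
    fun i P hP hP𝓛 => hC.2 ⟨i, P, hP, hP𝓛, rfl⟩
  have hQle : ∀ i, ∀ q ∈ InfoPrivacy.channelsQ ν p i, ∀ μ ∈ 𝓛 i, IsProbabilityMeasure μ →
      InfoPrivacy.mutualInfo (InfoPrivacy.jointLaw ν q μ) ≤ C₁ := by
    rintro i q ⟨-, κ, hκ, hqκ⟩ μ hμ hμp
    obtain rfl : q = fun a y => ∫⁻ z, (p (InfoPrivacy.dataset i a z) y : ℝ≥0∞) ∂κ a :=
      funext₂ hqκ
    rw [← InfoPrivacy.recordInfo_map_dataset hp μ κ]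
    refine hPle i _ ?_ ?_
    · exact Measure.isProbabilityMeasure_map (InfoPrivacy.measurable_dataset i).aemeasurable
    · rwa [InfoPrivacy.map_eval_map_dataset]
  obtain ⟨i, P, hP, hP𝓛, hPC⟩ := hC.1
  have hμ : IsProbabilityMeasure (P.map fun x => x i) :=
    Measure.isProbabilityMeasure_map (measurable_pi_apply i).aemeasurable
  obtain ⟨κ, hκ, hκP⟩ := InfoPrivacy.exists_kernel_map_dataset_eq P i
  have hqQ : (fun a y => ∫⁻ z, (p (InfoPrivacy.dataset i a z) y : ℝ≥0∞) ∂κ a) ∈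
      InfoPrivacy.channelsQ ν p i :=
    ⟨InfoPrivacy.isChannel_lintegral hp κ, κ, hκ, fun _ _ => rfl⟩
  rw [← hκP, InfoPrivacy.recordInfo_map_dataset hp] at hPC
  refine ⟨⟨⟨i, _, hqQ, _, hP𝓛, hμ, hPC⟩, ?_⟩, ?_, ?_⟩
  · rintro _ ⟨j, q, hq, μ, hμ𝓛, hμp, rfl⟩
    exact hQle j q hq μ hμ𝓛 hμp
  · obtain ⟨s, hs, hle⟩ := InfoPrivacy.exists_mem_channelsS_mutualInfo_le hp
      (P.map fun x => x i) hqQ ENNReal.coe_ne_top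
      (fun s hs => hQle i s (hS i hs) _ hP𝓛 hμ)
    exact ⟨i, s, hs, _, hP𝓛, hμ,
      (hPC.trans_le hle).antisymm (hQle i s (hS i hs) _ hP𝓛 hμ)⟩
  · rintro _ ⟨j, q, hq, μ, hμ𝓛, hμp, rfl⟩
    exact hQle j q (hS j hq) μ hμ𝓛 hμp
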